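/- An \emph{extended contact algebra} (ECA) is a Boolean algebra $\mathbf A$ with $0\neq 1$ together with a ternary relation $(a,b)\vdash c$ on $A$ such that, for all $a,b,d,e,f\in A$: if $(a,b)\vdash f$ then $(a\vee d,b)\vdash f\vee d$; if $(a,b)\vdash d$, $(a,b)\vdash e$ and $(d,e)\vdash f$ then $(a,b)\vdash f$; $(a,b)\vdash a\vee f$; if $(a,a)\vdash f$ then $a\le f$; if $(a,b)\vdash f$ then $(b,a)\vdash f$. A Boolean homomorphism $h\colon\mathbf A\to\mathbf B$ between ECAs is a \emph{reflecting ECA-morphism} if $(h(a),h(b))\vdash h(c)$ implies $(a,b)\vdash c$, a \emph{preserving ECA-morphism} if $(a,b)\vdash c$ implies $(h(a),h(b))\vdash h(c)$, and a \emph{similarity ECA-morphism} if it is both. Let $\mathsf{EC}_0,\mathsf{EC}_1,\mathsf{EC}_2$ be the categories of ECAs with reflecting, preserving and similarity ECA-morphisms, respectively. For a Boolean space $X$ (compact, Hausdorff, totally disconnected) let $\mathscr C_0(X)$ be the set of non-empty closed subsets and $\mathscr{CO}(X)$ the set of clopen subsets of $X$. For $\vec U=(U_1,U_2,U_3)\in\mathscr{CO}(X)^3$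 let $L_{\vec U}$ be the set of $\vec Y\in\mathscr C_0(X)^3$ with $Y_i\cap U_i\ne\emptyset$ for some $i$. For $R\subseteq X\times\mathscr C_0(X)^3$ put $R(x)=\{\vec Y:(x,\vec Y)\in R\}$, $R^{-1}(\vec Y)=\{x:(x,\vec Y)\in R\}$ (so $R^{-1}(\vec Y)=\emptyset$ if some $Y_i$ is empty), $\Diamond_R(\vec U)=\{x: \exists\,\vec Y\in R(x),\ Y_i\subseteq U_i \text{ for } i=1,2,3\}$ and $\Box_R(\vec U)=\{x:R(x)\subseteq L_{\vec U}\}$. A \emph{PSI-space} is a triple $(X,\tau,R)$ with $(X,\tau)$ a Boolean space and $R\subseteq X\times\mathscr C_0(X)^3$ such that (DF1) $\Diamond_R(\vec U)\in\mathscr{CO}(X)$ for all $\vec U\in\mathscr{CO}(X)^3$; (DF2) $R(x)=\bigcap\{L_{\vec U}:\vec U\in\mathscr{CO}(X)^3,\ x\in\Box_R(\vec U)\}$ for all $x\in X$; (DF3) if $\vec Y\in R(x)$, then $(\{y_1\},\{y_2\},Y_3)\in R(x)$ for some $y_1\in Y_1$, $y_2\in Y_2$; and for all $Y_1,Y_2,Y_3,Z,W\in\mathscr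 C_0(X)$: (PIF1) $R^{-1}(Y_1,Y_2,Y_3)\subseteq R^{-1}(Y_1,Y_2,Z)\cup R^{-1}(Y_1,Y_2,W)\cup R^{-1}(\mathrm{cl}(Z^c),\mathrm{cl}(W^c),Y_3)$; (PIF2) if $Y_1\cap Y_3=\emptyset$, then $R^{-1}(Y_1,Y_2,Y_3)=\emptyset$; (PIF3) $Y_1\cap Y_2\subseteq R^{-1}(Y_1,Y_1,Y_2)$; (PIF4) $R^{-1}(Y_1,Y_2,Y_3)\subseteq R^{-1}(Y_2,Y_1,Y_3)$. It is \emph{total} if, for every $\vec Z\in\mathscr C_0(X)^3$, $(x,\vec Z)\in R$ for some $x\in X$ implies $(y,\vec Z)\in R$ for all $y\in X$. Let $f\colon X_1\to X_2$ be a function between PSI-spaces such that $f^{-1}[U]\in\mathscr{CO}(X_1)$ for all $U\in\mathscr{CO}(X_2)$. It is a \emph{semi-PSI map} if, whenever $(f(x),\vec Z)\in R_2$, there is $\vec Y\in R_1(x)$ with $f[Y_i]\subseteq Z_i$ for $i=1,2,3$; it is a \emph{hemi-PSI map} if $(x,\vec Y)\in R_1$ implies $(f(x),(f[Y_1],f[Y_2],f[Y_3]))\in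 R_2$; it is a \emph{PSI map} if it is both. Let $\mathsf{PSISp}_0,\mathsf{PSISp}_1,\mathsf{PSISp}_2$ be the categories of PSI-spaces with semi-PSI maps, hemi-PSI maps and PSI maps, respectively, and let $\mathsf{tPSISp}_j$ be the full subcategory of $\mathsf{PSISp}_j$ on the non-empty total PSI-spaces. \textbf{Theorem.} The categories $\mathsf{EC}_0$, $\mathsf{EC}_1$ and $\mathsf{EC}_2$ are dually equivalent to $\mathsf{tPSISp}_0$, $\mathsf{tPSISp}_1$ and $\mathsf{tPSISp}_2$, respectively. -/

import Mathlib

open CategoryTheory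

universe u

namespace ExtContact

/-! ## Extended contact algebras and their morphisms -/

/-- An extended contact algebra: a non-degenerate Boolean algebra with a ternary relation
`Ent a b c`, read `(a, b) ⊢ c`. -/
structure ECA : Type (u + 1) where
  carrier : Type u
  [boolAlg : BooleanAlgebra carrier]
  [nontriv : Nontrivial carrier]
  Ent : carrier → carrier → carrier → Prop
  ec0 : ∀ a b d f, Ent a b f → Ent (a ⊔ d) b (f ⊔ d)
  ec1 : ∀ a b d e f, Ent a b d → Ent a b e → Ent d e f → Ent a b f
  ec2 : ∀ a b f, Ent a b (a ⊔ f)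
  ec3 : ∀ a f, Ent a a f → a ≤ f
  ec4 : ∀ a b f, Ent a b f → Ent b a f

instance : CoeSort ECA.{u} (Type u) := ⟨ECA.carrier⟩

instance (A : ECA.{u}) : BooleanAlgebra A := A.boolAlg

instance (A : ECA.{u}) : Nontrivial A := A.nontriv

/-- A Boolean homomorphism that reflects `⊢`. -/
def IsReflecting {A B : ECA.{u}} (h : BoundedLatticeHom A B) : Prop :=
  ∀ a b c : A, B.Ent (h a) (h b) (h c) → A.Ent a b c

/-- A Boolean homomorphism that preserves `⊢`. -/
def IsPreserving {A B : ECA.{u}} (h : BoundedLatticeHom A B) : Prop :=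
  ∀ a b c : A, A.Ent a b c → B.Ent (h a) (h b) (h c)

/-- A Boolean homomorphism that both reflects and preserves `⊢`. -/
def IsSimilarity {A B : ECA.{u}} (h : BoundedLatticeHom A B) : Prop :=
  IsReflecting h ∧ IsPreserving h

/-- Objects of the category of extended contact algebras with reflecting ECA-morphisms. -/
structure EC0 : Type (u + 1) where
  toECA : ECA.{u}

/-- Objects of the category of extended contact algebras with preserving ECA-morphisms. -/
structure EC1 : Type (u + 1) where
  toECA : ECA.{u}

/-- Objects of the category of extended contact algebras with similarity ECA-morphisms. -/
structure EC2 : Type (u + 1) where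
  toECA : ECA.{u}

instance : Category.{u} EC0.{u} where
  Hom A B := { h : BoundedLatticeHom A.toECA B.toECA // IsReflecting h }
  id A := ⟨BoundedLatticeHom.id _, fun _ _ _ h => h⟩
  comp f g := ⟨g.1.comp f.1, fun a b c h => f.2 a b c (g.2 _ _ _ h)⟩

instance : Category.{u} EC1.{u} where
  Hom A B := { h : BoundedLatticeHom A.toECA B.toECA // IsPreserving h }
  id A := ⟨BoundedLatticeHom.id _, fun _ _ _ h => h⟩
  comp f g := ⟨g.1.comp f.1, fun a b c h => g.2 _ _ _ (f.2 a b c h)⟩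

instance : Category.{u} EC2.{u} where
  Hom A B := { h : BoundedLatticeHom A.toECA B.toECA // IsSimilarity h }
  id A := ⟨BoundedLatticeHom.id _, fun _ _ _ h => h, fun _ _ _ h => h⟩
  comp f g := ⟨g.1.comp f.1, fun a b c h => f.2.1 a b c (g.2.1 _ _ _ h),
    fun a b c h => g.2.2 _ _ _ (f.2.2 a b c h)⟩

/-! ## Pseudo-inference spaces

A relation between points of `X` and triples of non-empty closed subsets of `X` is represented
by `R : X → Set X → Set X → Set X → Prop`; that it only relates points to triples of non-empty
closed sets is a clause of `IsPSIFrame`. -/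

/-- Membership in the family of non-empty closed subsets of `X`. -/
def IsClosed0 {X : Type u} [TopologicalSpace X] (Y : Set X) : Prop :=
  IsClosed Y ∧ Y.Nonempty

/-- `(Y₁, Y₂, Y₃)` meets `(U₁, U₂, U₃)` in at least one coordinate, i.e. it belongs to `L_U`. -/
def Meets {X : Type u} (Y₁ Y₂ Y₃ U₁ U₂ U₃ : Set X) : Prop :=
  (Y₁ ∩ U₁).Nonempty ∨ (Y₂ ∩ U₂).Nonempty ∨ (Y₃ ∩ U₃).Nonempty

/-- `◇_R(U)`: the points `x` such that some triple in `R(x)` lies outside `L_{Uᶜ}`. -/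
def diamondR {X : Type u} (R : X → Set X → Set X → Set X → Prop) (U₁ U₂ U₃ : Set X) : Set X :=
  {x | ∃ Y₁ Y₂ Y₃, R x Y₁ Y₂ Y₃ ∧ ¬ Meets Y₁ Y₂ Y₃ U₁ᶜ U₂ᶜ U₃ᶜ}

/-- `□_R(U)`: the points `x` such that `R(x) ⊆ L_U`. -/
def boxR {X : Type u} (R : X → Set X → Set X → Set X → Prop) (U₁ U₂ U₃ : Set X) : Set X :=
  {x | ∀ Y₁ Y₂ Y₃, R x Y₁ Y₂ Y₃ → Meets Y₁ Y₂ Y₃ U₁ U₂ U₃}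

/-- `R⁻¹(Y₁, Y₂, Y₃)`. -/
def preR {X : Type u} (R : X → Set X → Set X → Set X → Prop) (Y₁ Y₂ Y₃ : Set X) : Set X :=
  {x | R x Y₁ Y₂ Y₃}

/-- The axioms of a descriptive PSI-frame on a topological space. -/
structure IsPSIFrame (X : Type u) [TopologicalSpace X]
    (R : X → Set X → Set X → Set X → Prop) : Prop where
  closed0 : ∀ x Y₁ Y₂ Y₃, R x Y₁ Y₂ Y₃ → IsClosed0 Y₁ ∧ IsClosed0 Y₂ ∧ IsClosed0 Y₃
  df1 : ∀ U₁ U₂ U₃ : Set X, IsClopen U₁ → IsClopen U₂ → IsClopen U₃ →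
    IsClopen (diamondR R U₁ U₂ U₃)
  df2 : ∀ (x : X) (Y₁ Y₂ Y₃ : Set X), IsClosed0 Y₁ → IsClosed0 Y₂ → IsClosed0 Y₃ →
    (R x Y₁ Y₂ Y₃ ↔ ∀ U₁ U₂ U₃ : Set X, IsClopen U₁ → IsClopen U₂ → IsClopen U₃ →
      x ∈ boxR R U₁ U₂ U₃ → Meets Y₁ Y₂ Y₃ U₁ U₂ U₃)
  df3 : ∀ x Y₁ Y₂ Y₃, R x Y₁ Y₂ Y₃ → ∃ y₁ ∈ Y₁, ∃ y₂ ∈ Y₂, R x {y₁} {y₂} Y₃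

/-- The axioms of a pseudo-inference space on a topological space. -/
structure IsPSISpace (X : Type u) [TopologicalSpace X]
    (R : X → Set X → Set X → Set X → Prop) : Prop extends IsPSIFrame X R where
  pif1 : ∀ Y₁ Y₂ Y₃ Z W : Set X, IsClosed0 Y₁ → IsClosed0 Y₂ → IsClosed0 Y₃ →
    IsClosed0 Z → IsClosed0 W →
    preR R Y₁ Y₂ Y₃ ⊆ preR R Y₁ Y₂ Z ∪ preR R Y₁ Y₂ W ∪ preR R (closure Zᶜ) (closure Wᶜ) Y₃
  pif2 : ∀ Y₁ Y₂ Y₃ : Set X, IsClosed0 Y₁ → IsClosed0 Y₂ → IsClosed0 Y₃ →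
    Y₁ ∩ Y₃ = ∅ → preR R Y₁ Y₂ Y₃ = ∅
  pif3 : ∀ Y₁ Y₂ : Set X, IsClosed0 Y₁ → IsClosed0 Y₂ → Y₁ ∩ Y₂ ⊆ preR R Y₁ Y₁ Y₂
  pif4 : ∀ Y₁ Y₂ Y₃ : Set X, IsClosed0 Y₁ → IsClosed0 Y₂ → IsClosed0 Y₃ →
    preR R Y₁ Y₂ Y₃ ⊆ preR R Y₂ Y₁ Y₃

/-- A pseudo-inference space: a Boolean space with a relation satisfying the axioms. -/
structure PSISpace : Type (u + 1) where
  carrier : Type u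
  [top : TopologicalSpace carrier]
  [compact : CompactSpace carrier]
  [t2 : T2Space carrier]
  [totDisc : TotallyDisconnectedSpace carrier]
  R : carrier → Set carrier → Set carrier → Set carrier → Prop
  isPSI : IsPSISpace carrier R

instance : CoeSort PSISpace.{u} (Type u) := ⟨PSISpace.carrier⟩

instance (X : PSISpace.{u}) : TopologicalSpace X := X.top

instance (X : PSISpace.{u}) : CompactSpace X := X.compact

instance (X : PSISpace.{u}) : T2Space X := X.t2

instance (X : PSISpace.{u}) : TotallyDisconnectedSpace X := X.totDisc

/-- Preimages of clopen sets are clopen. -/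
def PullsBackClopens {X₁ X₂ : PSISpace.{u}} (f : X₁ → X₂) : Prop :=
  ∀ U : Set X₂, IsClopen U → IsClopen (f ⁻¹' U)

/-- The forth condition: `R₁(x, Y)` implies `R₂(f x, f[Y])`. -/
def Forth {X₁ X₂ : PSISpace.{u}} (f : X₁ → X₂) : Prop :=
  ∀ (x : X₁) (Y₁ Y₂ Y₃ : Set X₁), X₁.R x Y₁ Y₂ Y₃ → X₂.R (f x) (f '' Y₁) (f '' Y₂) (f '' Y₃)

/-- The back condition: `R₂(f x, Z)` implies `R₁(x, Y)` for some `Y` with `f[Y] ⊆ Z`. -/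
def Back {X₁ X₂ : PSISpace.{u}} (f : X₁ → X₂) : Prop :=
  ∀ (x : X₁) (Z₁ Z₂ Z₃ : Set X₂), X₂.R (f x) Z₁ Z₂ Z₃ →
    ∃ Y₁ Y₂ Y₃ : Set X₁, X₁.R x Y₁ Y₂ Y₃ ∧ f '' Y₁ ⊆ Z₁ ∧ f '' Y₂ ⊆ Z₂ ∧ f '' Y₃ ⊆ Z₃

/-- Semi-PSI maps are the duals of semi-homomorphisms, hence of reflecting ECA-morphisms;
the condition dual to these is the back condition. -/
def IsSemiPSIMap {X₁ X₂ : PSISpace.{u}} (f : X₁ → X₂) : Prop :=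
  PullsBackClopens f ∧ Back f

/-- Hemi-PSI maps are the duals of hemi-homomorphisms, hence of preserving ECA-morphisms;
the condition dual to these is the forth condition. -/
def IsHemiPSIMap {X₁ X₂ : PSISpace.{u}} (f : X₁ → X₂) : Prop :=
  PullsBackClopens f ∧ Forth f

/-- PSI maps: both semi-PSI and hemi-PSI. -/
def IsPSIMap {X₁ X₂ : PSISpace.{u}} (f : X₁ → X₂) : Prop :=
  IsSemiPSIMap f ∧ IsHemiPSIMap f

theorem isSemiPSIMap_id (X : PSISpace.{u}) : IsSemiPSIMap (id : X → X) :=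
  ⟨fun _ h => h, fun _ Z₁ Z₂ Z₃ h => ⟨Z₁, Z₂, Z₃, h, by simp, by simp, by simp⟩⟩

theorem isHemiPSIMap_id (X : PSISpace.{u}) : IsHemiPSIMap (id : X → X) :=
  ⟨fun _ h => h, fun _ _ _ _ h => by simpa using h⟩

theorem IsSemiPSIMap.comp {X₁ X₂ X₃ : PSISpace.{u}} {g : X₂ → X₃} {f : X₁ → X₂}
    (hg : IsSemiPSIMap g) (hf : IsSemiPSIMap f) : IsSemiPSIMap (g ∘ f) := by
  refine ⟨fun U hU => hf.1 _ (hg.1 U hU), fun x Z₁ Z₂ Z₃ h => ?_⟩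
  obtain ⟨W₁, W₂, W₃, hW, h₁, h₂, h₃⟩ := hg.2 (f x) Z₁ Z₂ Z₃ h
  obtain ⟨Y₁, Y₂, Y₃, hY, k₁, k₂, k₃⟩ := hf.2 x W₁ W₂ W₃ hW
  refine ⟨Y₁, Y₂, Y₃, hY, ?_, ?_, ?_⟩ <;> rw [Set.image_comp]
  · exact (Set.image_mono k₁).trans h₁
  · exact (Set.image_mono k₂).trans h₂
  · exact (Set.image_mono k₃).trans h₃

theorem IsHemiPSIMap.comp {X₁ X₂ X₃ : PSISpace.{u}} {g : X₂ → X₃} {f : X₁ → X₂}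
    (hg : IsHemiPSIMap g) (hf : IsHemiPSIMap f) : IsHemiPSIMap (g ∘ f) := by
  refine ⟨fun U hU => hf.1 _ (hg.1 U hU), fun x Y₁ Y₂ Y₃ h => ?_⟩
  simp only [Set.image_comp]
  exact hg.2 _ _ _ _ (hf.2 x Y₁ Y₂ Y₃ h)

/-- Objects of the category of PSI-spaces with semi-PSI maps. -/
structure PSISp0 : Type (u + 1) where
  toPSISpace : PSISpace.{u}

/-- Objects of the category of PSI-spaces with hemi-PSI maps. -/
structure PSISp1 : Type (u + 1) where
  toPSISpace : PSISpace.{u}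

/-- Objects of the category of PSI-spaces with PSI maps. -/
structure PSISp2 : Type (u + 1) where
  toPSISpace : PSISpace.{u}

instance : Category.{u} PSISp0.{u} where
  Hom X Y := { f : X.toPSISpace → Y.toPSISpace // IsSemiPSIMap f }
  id X := ⟨id, isSemiPSIMap_id _⟩
  comp f g := ⟨g.1 ∘ f.1, g.2.comp f.2⟩

instance : Category.{u} PSISp1.{u} where
  Hom X Y := { f : X.toPSISpace → Y.toPSISpace // IsHemiPSIMap f }
  id X := ⟨id, isHemiPSIMap_id _⟩
  comp f g := ⟨g.1 ∘ f.1, g.2.comp f.2⟩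

instance : Category.{u} PSISp2.{u} where
  Hom X Y := { f : X.toPSISpace → Y.toPSISpace // IsPSIMap f }
  id X := ⟨id, isSemiPSIMap_id _, isHemiPSIMap_id _⟩
  comp f g := ⟨g.1 ∘ f.1, g.2.1.comp f.2.1, g.2.2.comp f.2.2⟩

/-- A PSI-space is total if each triple of non-empty closed sets related to some point is related
to every point. -/
def PSISpace.IsTotal (X : PSISpace.{u}) : Prop :=
  ∀ Z₁ Z₂ Z₃ : Set X, IsClosed0 Z₁ → IsClosed0 Z₂ → IsClosed0 Z₃ →
    (∃ x : X, X.R x Z₁ Z₂ Z₃) → ∀ y : X, X.R y Z₁ Z₂ Z₃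

/-- Full subcategory of `PSISp0` on the non-empty total PSI-spaces (non-emptiness corresponds to
non-degeneracy of extended contact algebras). -/
abbrev TPSISp0 : Type (u + 1) :=
  ObjectProperty.FullSubcategory
    (fun X : PSISp0.{u} => Nonempty X.toPSISpace ∧ X.toPSISpace.IsTotal)

/-- Full subcategory of `PSISp1` on the non-empty total PSI-spaces. -/
abbrev TPSISp1 : Type (u + 1) :=
  ObjectProperty.FullSubcategory
    (fun X : PSISp1.{u} => Nonempty X.toPSISpace ∧ X.toPSISpace.IsTotal)

/-- Full subcategory of `PSISp2` on the non-empty total PSI-spaces. -/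
abbrev TPSISp2 : Type (u + 1) :=
  ObjectProperty.FullSubcategory
    (fun X : PSISp2.{u} => Nonempty X.toPSISpace ∧ X.toPSISpace.IsTotal)

end ExtContact

/-!
On a Boolean space `X`, a relation between points and triples of closed sets induces an entailment
on the clopen sets, and an entailment singles out the triples of closed sets that it does not
refute, regardless of the point. If the relation is total then (DF2) says that exactly the
unrefuted triples are related; conversely every entailment is recovered from its unrefuted triples,
because a triple of clopen sets is closed. Compactness gives (DF3), as a closed set is refuted as
soon as all its points are. Hence total PSI-relations and entailments on `X` determine each other.

By Stone duality, Boolean homomorphisms between clopen algebras are the inverse image maps of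
continuous maps `f`. Images under `f` show that the homomorphism preserves entailment if and only if
`f` satisfies the forth condition. Dually, a homomorphism reflecting entailment transports
refutations from `f⁻¹[Z]` to `Z`, since a clopen neighbourhood of `f⁻¹[Z]` contains the preimage of
a clopen neighbourhood of `Z`; this is the back condition.
-/

namespace ExtContact

open TopologicalSpace Set Opposite

/-! ### Entailment relations -/

/-- The laws of `⊢` in an extended contact algebra, as a property of a ternary relation. Separating
them from the carrier lets one compare entailments and inference relations on a fixed space. -/
structure IsEntailment {B : Type*} [SemilatticeSup B] (E : B → B → B → Prop) : Prop where
  sup_right {a b f : B} (d : B) : E a b f → E (a ⊔ d) b (f ⊔ d)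
  cut {a b d e f : B} : E a b d → E a b e → E d e f → E a b f
  left_sup (a b f : B) : E a b (a ⊔ f)
  le_of_self {a f : B} : E a a f → a ≤ f
  symm {a b f : B} : E a b f → E b a f

theorem ECA.isEntailment (A : ECA.{u}) : IsEntailment A.Ent where
  sup_right d := A.ec0 _ _ d _
  cut := A.ec1 _ _ _ _ _
  left_sup := A.ec2
  le_of_self := A.ec3 _ _
  symm := A.ec4 _ _ _

namespace IsEntailment

section SemilatticeSup

variable {B B' : Type*} [SemilatticeSup B] [SemilatticeSup B'] {E : B → B → B → Prop}
  {a a' b b' c c' : B}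

theorem comap (hE : IsEntailment E) (e : B' ≃o B) :
    IsEntailment fun a b c => E (e a) (e b) (e c) where
  sup_right d h := by simpa only [map_sup] using hE.sup_right (e d) h
  cut := hE.cut
  left_sup a b f := by simpa only [map_sup] using hE.left_sup (e a) (e b) (e f)
  le_of_self h := e.le_iff_le.1 (hE.le_of_self h)
  symm := hE.symm

theorem of_le_left (hE : IsEntailment E) (h : a ≤ c) : E a b c := by
  simpa only [sup_eq_right.2 h] using hE.left_sup a b c

theorem of_le_right (hE : IsEntailment E) (h : b ≤ c) : E a b c :=
  hE.symm (hE.of_le_left h)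

theorem mono (hE : IsEntailment E) (ha : a ≤ a') (hb : b ≤ b') (hc : c' ≤ c) (h : E a' b' c') :
    E a b c :=
  have h' : E a b c' := hE.cut (hE.of_le_left ha) (hE.of_le_right hb) h
  hE.cut h' h' (hE.of_le_left hc)

theorem sup_left (hE : IsEntailment E) (h : E a b c) (h' : E a' b c) : E (a ⊔ a') b c := by
  have h₁ : E (a ⊔ a') b (c ⊔ a') := hE.sup_right a' h
  have h₂ : E (c ⊔ a') b c := by
    simpa only [sup_comm a' c, sup_idem] using hE.sup_right c h'
  exact hE.cut h₁ (hE.of_le_right le_rfl) h₂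

end SemilatticeSup

theorem inf_le {B : Type*} [Lattice B] {E : B → B → B → Prop} {a b c : B} (hE : IsEntailment E)
    (h : E a b c) : a ⊓ b ≤ c :=
  hE.le_of_self (hE.mono inf_le_left inf_le_right le_rfl h)

end IsEntailment

/-! ### From inference relations to entailments -/

theorem isClosed0_singleton {X : Type u} [TopologicalSpace X] [T1Space X] (x : X) :
    IsClosed0 ({x} : Set X) :=
  ⟨isClosed_singleton, singleton_nonempty x⟩

theorem meets_iff {X : Type u} {Y₁ Y₂ Y₃ U₁ U₂ U₃ : Set X} :
    Meets Y₁ Y₂ Y₃ U₁ U₂ U₃ ↔ (Y₁ ⊆ U₁ᶜ → Y₂ ⊆ U₂ᶜ → ¬ Disjoint Y₃ U₃) := by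
  simp only [Meets, ← not_disjoint_iff_nonempty_inter, subset_compl_iff_disjoint_right]
  tauto

/-- The inference relation that a relation `R` between points and triples of closed sets induces on
clopen sets: `(U, V) ⊢ W` when no related triple has its coordinates inside `U`, `V` and `Wᶜ`. -/
def clopenEnt {X : Type u} [TopologicalSpace X] (R : X → Set X → Set X → Set X → Prop)
    (U V W : Clopens X) : Prop :=
  ∀ x Y₁ Y₂ Y₃, R x Y₁ Y₂ Y₃ → Y₁ ⊆ U → Y₂ ⊆ V → ¬ Disjoint Y₃ (W : Set X)

section InferenceRelation

variable {X : Type u} [TopologicalSpace X] {R : X → Set X → Set X → Set X → Prop}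

theorem IsPSIFrame.clopenEnt_iff_singleton (hR : IsPSIFrame X R) {U V W : Clopens X} :
    clopenEnt R U V W ↔ ∀ x y₁ y₂ Y₃, R x {y₁} {y₂} Y₃ → y₁ ∈ U → y₂ ∈ V →
      ¬ Disjoint Y₃ (W : Set X) := by
  refine ⟨fun h x y₁ y₂ Y₃ hY hU hV => h x _ _ _ hY (singleton_subset_iff.2 hU)
    (singleton_subset_iff.2 hV), fun h x Y₁ Y₂ Y₃ hY hU hV => ?_⟩
  obtain ⟨y₁, hy₁, y₂, hy₂, hy⟩ := hR.df3 x Y₁ Y₂ Y₃ hY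
  exact h x y₁ y₂ Y₃ hy (hU hy₁) (hV hy₂)

namespace IsPSISpace

theorem not_disjoint_of_rel (hR : IsPSISpace X R) {x : X} {Y₁ Y₂ Y₃ : Set X}
    (h : R x Y₁ Y₂ Y₃) : ¬ Disjoint Y₁ Y₃ := fun hd => by
  obtain ⟨h₁, h₂, h₃⟩ := hR.closed0 _ _ _ _ h
  exact (hR.pif2 Y₁ Y₂ Y₃ h₁ h₂ h₃ hd.inter_eq).subset h

theorem mem_of_rel_singleton (hR : IsPSISpace X R) {x y : X} {Y₂ Y₃ : Set X}
    (h : R x {y} Y₂ Y₃) : y ∈ Y₃ :=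
  not_not.1 (disjoint_singleton_left.not.1 (hR.not_disjoint_of_rel h))

theorem rel_swap (hR : IsPSISpace X R) {x : X} {Y₁ Y₂ Y₃ : Set X} (h : R x Y₁ Y₂ Y₃) :
    R x Y₂ Y₁ Y₃ :=
  have ⟨h₁, h₂, h₃⟩ := hR.closed0 _ _ _ _ h
  hR.pif4 Y₁ Y₂ Y₃ h₁ h₂ h₃ h

theorem rel_singleton [T1Space X] (hR : IsPSISpace X R) (x : X) : R x {x} {x} {x} :=
  hR.pif3 {x} {x} (isClosed0_singleton x) (isClosed0_singleton x) ⟨rfl, rfl⟩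

theorem exists_not_rel [T1Space X] [Nontrivial X] (hR : IsPSISpace X R) {x y₁ y₂ : X}
    (D : Clopens X) (hD : ∀ Y, R x {y₁} {y₂} Y → ¬ Disjoint Y (D : Set X)) :
    ∃ Z, IsClosed0 Z ∧ closure Zᶜ ⊆ D ∧ ¬ R x {y₁} {y₂} Z := by
  rcases eq_or_ne D ⊤ with rfl | hne
  · obtain ⟨z, hz⟩ := exists_ne y₁
    exact ⟨{z}, isClosed0_singleton z, subset_univ _,
      fun h => hz (hR.mem_of_rel_singleton h).symm⟩
  · refine ⟨(D : Set X)ᶜ, ⟨D.isOpen.isClosed_compl, ?_⟩, ?_, fun h => hD _ h disjoint_compl_left⟩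
    · exact nonempty_compl.2 fun h => hne (Clopens.ext h)
    · rw [compl_compl, D.isClosed.closure_eq]

theorem clopenEnt_sup_right (hR : IsPSISpace X R) {U V W : Clopens X} (D : Clopens X)
    (h : clopenEnt R U V W) : clopenEnt R (U ⊔ D) V (W ⊔ D) := by
  refine hR.clopenEnt_iff_singleton.2 fun x y₁ y₂ Y₃ hY hy₁ hy₂ => ?_
  rw [Clopens.coe_sup, disjoint_union_right]
  rintro ⟨hYW, hYD⟩
  rcases hy₁ with hU | hD
  · exact hR.clopenEnt_iff_singleton.1 h x y₁ y₂ Y₃ hY hU hy₂ hYW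
  · exact disjoint_left.1 hYD (hR.mem_of_rel_singleton hY) hD

-- (PIF1) is applied to the complements of `D` and `E`, which may be empty; `exists_not_rel`
-- replaces an empty one by a singleton, and this requires a second point.
theorem clopenEnt_cut [T1Space X] (hR : IsPSISpace X R) {U V W D E : Clopens X}
    (hD : clopenEnt R U V D) (hE : clopenEnt R U V E) (hW : clopenEnt R D E W) :
    clopenEnt R U V W := by
  rw [hR.clopenEnt_iff_singleton] at hD hE ⊢
  intro x y₁ y₂ Y₃ hY hU hV
  rcases subsingleton_or_nontrivial X with hX | hX
  · obtain ⟨d, -, hd⟩ := not_disjoint_iff.1 (hD x y₁ y₂ Y₃ hY hU hV)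
    obtain ⟨e, -, he⟩ := not_disjoint_iff.1 (hE x y₁ y₂ Y₃ hY hU hV)
    exact hR.clopenEnt_iff_singleton.1 hW x y₁ y₂ Y₃ hY (Subsingleton.elim d y₁ ▸ hd)
      (Subsingleton.elim e y₂ ▸ he)
  · obtain ⟨Z, hZ, hZD, hnZ⟩ := hR.exists_not_rel D fun Y h => hD x y₁ y₂ Y h hU hV
    obtain ⟨Z', hZ', hZE, hnZ'⟩ := hR.exists_not_rel E fun Y h => hE x y₁ y₂ Y h hU hV
    have hY₃ : IsClosed0 Y₃ := (hR.closed0 _ _ _ _ hY).2.2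
    rcases hR.pif1 {y₁} {y₂} Y₃ Z Z' (isClosed0_singleton _) (isClosed0_singleton _) hY₃ hZ hZ' hY
      with (h | h) | h
    · exact absurd h hnZ
    · exact absurd h hnZ'
    · exact hW x _ _ _ h hZD hZE

theorem isEntailment_clopenEnt [T1Space X] (hR : IsPSISpace X R) :
    IsEntailment (clopenEnt R) where
  sup_right := hR.clopenEnt_sup_right
  cut := hR.clopenEnt_cut
  left_sup _ _ _ _ _ _ _ hY hU _ hd :=
    hR.not_disjoint_of_rel hY (hd.symm.mono_left (hU.trans subset_union_left))
  le_of_self {U W} h x hx := by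
    have hxU : ({x} : Set X) ⊆ U := singleton_subset_iff.2 hx
    simpa using h x {x} {x} {x} (hR.rel_singleton x) hxU hxU
  symm h x Y₁ Y₂ Y₃ hY hV hU := h x Y₂ Y₁ Y₃ (hR.rel_swap hY) hU hV

end IsPSISpace

end InferenceRelation

/-! ### From entailments to inference relations -/

section Refutes

variable {X : Type u} [TopologicalSpace X]

/-- An entailment `E` on clopen sets refutes a triple of sets when some `(U, V) ⊢ W` excludes it.
The relation dual to `E` consists of the triples of closed sets that `E` does not refute. -/
def Refutes (E : Clopens X → Clopens X → Clopens X → Prop) (Y₁ Y₂ Y₃ : Set X) : Prop :=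
  ∃ U V W : Clopens X, E U V W ∧ Y₁ ⊆ U ∧ Y₂ ⊆ V ∧ Disjoint Y₃ (W : Set X)

variable {E : Clopens X → Clopens X → Clopens X → Prop} {Y₁ Y₁' Y₂ Y₂' Y₃ Y₃' : Set X}

namespace Refutes

theorem mono (h₁ : Y₁ ⊆ Y₁') (h₂ : Y₂ ⊆ Y₂') (h₃ : Y₃ ⊆ Y₃') :
    Refutes E Y₁' Y₂' Y₃' → Refutes E Y₁ Y₂ Y₃ :=
  fun ⟨U, V, W, hUVW, hU, hV, hW⟩ =>
    ⟨U, V, W, hUVW, h₁.trans hU, h₂.trans hV, hW.mono_left h₃⟩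

theorem swap (hE : IsEntailment E) : Refutes E Y₁ Y₂ Y₃ → Refutes E Y₂ Y₁ Y₃ :=
  fun ⟨U, V, W, hUVW, hU, hV, hW⟩ => ⟨V, U, W, hE.symm hUVW, hV, hU, hW⟩

theorem empty_left (hE : IsEntailment E) : Refutes E ∅ Y₂ Y₃ :=
  ⟨⊥, ⊤, ⊥, hE.of_le_left le_rfl, empty_subset _, subset_univ _, disjoint_empty _⟩

theorem empty_right (hE : IsEntailment E) : Refutes E Y₁ Y₂ ∅ :=
  ⟨⊤, ⊤, ⊤, hE.of_le_left le_rfl, subset_univ _, subset_univ _, empty_disjoint _⟩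

theorem union_left (hE : IsEntailment E) :
    Refutes E Y₁ Y₂ Y₃ → Refutes E Y₁' Y₂ Y₃ → Refutes E (Y₁ ∪ Y₁') Y₂ Y₃ :=
  fun ⟨U, V, W, h, hU, hV, hW⟩ ⟨U', V', W', h', hU', hV', hW'⟩ =>
    ⟨U ⊔ U', V ⊓ V', W ⊔ W',
      hE.sup_left (hE.mono le_rfl inf_le_left le_sup_left h)
        (hE.mono le_rfl inf_le_right le_sup_right h'),
      union_subset_union hU hU', subset_inter hV hV', disjoint_union_right.2 ⟨hW, hW'⟩⟩

theorem of_forall_singleton (hE : IsEntailment E) (hY₁ : IsCompact Y₁)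
    (h : ∀ y ∈ Y₁, Refutes E {y} Y₂ Y₃) : Refutes E Y₁ Y₂ Y₃ := by
  refine hY₁.induction_on (p := fun L => Refutes E L Y₂ Y₃) (empty_left hE)
    (fun s t hst => mono hst subset_rfl subset_rfl) (fun s t => union_left hE) fun y hy => ?_
  obtain ⟨U, V, W, hUVW, hU, hV, hW⟩ := h y hy
  exact ⟨U, mem_nhdsWithin_of_mem_nhds (U.isOpen.mem_nhds (hU rfl)),
    U, V, W, hUVW, subset_rfl, hV, hW⟩

theorem cut (hE : IsEntailment E) {Z Z' : Set X} :
    Refutes E Y₁ Y₂ Z → Refutes E Y₁ Y₂ Z' → Refutes E Zᶜ Z'ᶜ Y₃ → Refutes E Y₁ Y₂ Y₃ := by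
  rintro ⟨U, V, D, hD, hU, hV, hZD⟩ ⟨U', V', D', hD', hU', hV', hZD'⟩ ⟨P, Q, W, hW, hP, hQ, hYW⟩
  have hDP : D ≤ P := hZD.subset_compl_left.trans hP
  have hDQ : D' ≤ Q := hZD'.subset_compl_left.trans hQ
  have hW' : E (U ⊓ U') (V ⊓ V') W :=
    hE.cut (hE.mono inf_le_left inf_le_left le_rfl hD)
      (hE.mono inf_le_right inf_le_right le_rfl hD') (hE.mono hDP hDQ le_rfl hW)
  exact ⟨U ⊓ U', V ⊓ V', W, hW', subset_inter hU hU', subset_inter hV hV', hYW⟩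

theorem of_disjoint [CompactSpace X] [T2Space X] [TotallyDisconnectedSpace X]
    (hE : IsEntailment E) (h₁ : IsClosed Y₁) (h₃ : IsClosed Y₃) (h : Disjoint Y₁ Y₃) :
    Refutes E Y₁ Y₂ Y₃ := by
  obtain ⟨U, hU, hYU, hUY⟩ :=
    exists_clopen_of_closed_subset_open h₁ h₃.isOpen_compl h.subset_compl_right
  exact ⟨⟨U, hU⟩, ⊤, ⟨U, hU⟩, hE.of_le_left le_rfl, hYU, subset_univ _,
    (subset_compl_iff_disjoint_right.1 hUY).symm⟩

end Refutes

theorem not_refutes_of_mem (hE : IsEntailment E) {x : X} (h₁ : x ∈ Y₁) (h₂ : x ∈ Y₂)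
    (h₃ : x ∈ Y₃) : ¬ Refutes E Y₁ Y₂ Y₃ :=
  fun ⟨_, _, _, hUVW, hU, hV, hW⟩ =>
    disjoint_left.1 hW h₃ (hE.inf_le hUVW ⟨hU h₁, hV h₂⟩)

theorem refutes_coe_compl_iff (hE : IsEntailment E) {U V W : Clopens X} :
    Refutes E U V (W : Set X)ᶜ ↔ E U V W :=
  ⟨fun ⟨_, _, _, h, hU, hV, hW⟩ => hE.mono hU hV (disjoint_compl_left_iff_subset.1 hW) h,
    fun h => ⟨U, V, W, h, subset_rfl, subset_rfl, disjoint_compl_left⟩⟩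

/-- The relation between triples of closed sets dual to an entailment `E` on clopen sets. It is not
required that the sets be non-empty, since a triple with an empty coordinate is refuted. -/
def closedRel (E : Clopens X → Clopens X → Clopens X → Prop) (Y₁ Y₂ Y₃ : Set X) : Prop :=
  IsClosed Y₁ ∧ IsClosed Y₂ ∧ IsClosed Y₃ ∧ ¬ Refutes E Y₁ Y₂ Y₃

theorem closedRel.isClosed0 (hE : IsEntailment E) (h : closedRel E Y₁ Y₂ Y₃) :
    IsClosed0 Y₁ ∧ IsClosed0 Y₂ ∧ IsClosed0 Y₃ := by
  obtain ⟨h₁, h₂, h₃, hn⟩ := h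
  refine ⟨⟨h₁, nonempty_iff_ne_empty.2 ?_⟩, ⟨h₂, nonempty_iff_ne_empty.2 ?_⟩,
    ⟨h₃, nonempty_iff_ne_empty.2 ?_⟩⟩ <;> rintro rfl
  · exact hn (.empty_left hE)
  · exact hn (.swap hE (.empty_left hE))
  · exact hn (.empty_right hE)

theorem closedRel.swap (hE : IsEntailment E) (h : closedRel E Y₁ Y₂ Y₃) : closedRel E Y₂ Y₁ Y₃ :=
  ⟨h.2.1, h.1, h.2.2.1, fun hr => h.2.2.2 (hr.swap hE)⟩

theorem closedRel.exists_singleton_left [CompactSpace X] [T1Space X] (hE : IsEntailment E)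
    (h : closedRel E Y₁ Y₂ Y₃) : ∃ y ∈ Y₁, closedRel E {y} Y₂ Y₃ := by
  obtain ⟨h₁, h₂, h₃, hn⟩ := h
  by_contra! hall
  exact hn (.of_forall_singleton hE h₁.isCompact fun y hy =>
    by_contra fun hy' => hall y hy ⟨isClosed_singleton, h₂, h₃, hy'⟩)

theorem isPSIFrame_closedRel [CompactSpace X] [T1Space X] (hE : IsEntailment E) :
    IsPSIFrame X fun _ => closedRel E where
  closed0 _ _ _ _ h := h.isClosed0 hE
  df1 _ _ _ _ _ _ := ⟨isClosed_const, isOpen_const⟩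
  df2 x Y₁ Y₂ Y₃ h₁ h₂ h₃ := by
    refine ⟨fun h U₁ U₂ U₃ _ _ _ hx => hx _ _ _ h, fun h => ⟨h₁.1, h₂.1, h₃.1, ?_⟩⟩
    rintro ⟨U, V, W, hUVW, hU, hV, hW⟩
    have hx : x ∈ boxR (fun _ => closedRel E) (U : Set X)ᶜ (V : Set X)ᶜ W := fun Z₁ Z₂ Z₃ hZ =>
      meets_iff.2 fun hZU hZV hZW =>
        hZ.2.2.2 ⟨U, V, W, hUVW, by simpa using hZU, by simpa using hZV, hZW⟩
    exact meets_iff.1 (h _ _ _ U.isClopen.compl V.isClopen.compl W.isClopen hx)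
      (by simpa using hU) (by simpa using hV) hW
  df3 _ _ _ _ h := by
    obtain ⟨y₁, hy₁, h'⟩ := h.exists_singleton_left hE
    obtain ⟨y₂, hy₂, h''⟩ := (h'.swap hE).exists_singleton_left hE
    exact ⟨y₁, hy₁, y₂, hy₂, h''.swap hE⟩

theorem isPSISpace_closedRel [CompactSpace X] [T2Space X] [TotallyDisconnectedSpace X]
    (hE : IsEntailment E) : IsPSISpace X fun _ => closedRel E where
  toIsPSIFrame := isPSIFrame_closedRel hE
  pif1 Y₁ Y₂ Y₃ Z W _ _ _ hZ hW x := by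
    rintro ⟨h₁, h₂, h₃, hn⟩
    by_contra hnot
    simp only [mem_union, preR, mem_ofPred_eq, closedRel, h₁, h₂, h₃, hZ.1, hW.1,
      isClosed_closure, true_and, not_or, not_not] at hnot
    obtain ⟨⟨hrZ, hrW⟩, hr⟩ := hnot
    exact hn (.cut hE hrZ hrW (hr.mono subset_closure subset_closure subset_rfl))
  pif2 Y₁ Y₂ Y₃ h₁ _ h₃ hd := eq_empty_of_forall_notMem fun x h =>
    h.2.2.2 (.of_disjoint hE h₁.1 h₃.1 (disjoint_iff_inter_eq_empty.2 hd))
  pif3 Y₁ Y₂ h₁ h₂ x hx := ⟨h₁.1, h₁.1, h₂.1, not_refutes_of_mem hE hx.1 hx.1 hx.2⟩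
  pif4 _ _ _ _ _ _ _ := closedRel.swap hE

theorem clopenEnt_closedRel_iff [Nonempty X] (hE : IsEntailment E) {U V W : Clopens X} :
    clopenEnt (fun _ => closedRel E) U V W ↔ E U V W := by
  rw [← refutes_coe_compl_iff hE]
  refine ⟨fun h => by_contra fun hn => ?_, fun h x Y₁ Y₂ Y₃ hY hU hV hW => ?_⟩
  · exact h (Classical.arbitrary X) U V (W : Set X)ᶜ
      ⟨U.isClosed, V.isClosed, W.isOpen.isClosed_compl, hn⟩ subset_rfl subset_rfl
      disjoint_compl_left
  · exact hY.2.2.2 (h.mono hU hV hW.subset_compl_right)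

end Refutes

theorem PSISpace.closedRel_of_rel {X : PSISpace.{u}} {x : X} {Y₁ Y₂ Y₃ : Set X}
    (h : X.R x Y₁ Y₂ Y₃) : closedRel (clopenEnt X.R) Y₁ Y₂ Y₃ :=
  have ⟨h₁, h₂, h₃⟩ := X.isPSI.closed0 _ _ _ _ h
  ⟨h₁.1, h₂.1, h₃.1, fun ⟨_, _, _, hUVW, hU, hV, hW⟩ => hUVW x _ _ _ h hU hV hW⟩

theorem PSISpace.IsTotal.rel_iff_closedRel {X : PSISpace.{u}} (hX : X.IsTotal) {x : X}
    {Y₁ Y₂ Y₃ : Set X} : X.R x Y₁ Y₂ Y₃ ↔ closedRel (clopenEnt X.R) Y₁ Y₂ Y₃ := by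
  refine ⟨closedRel_of_rel, fun h => ?_⟩
  obtain ⟨h₁, h₂, h₃⟩ := h.isClosed0 X.isPSI.isEntailment_clopenEnt
  refine (X.isPSI.df2 x Y₁ Y₂ Y₃ h₁ h₂ h₃).2 fun U₁ U₂ U₃ hU₁ hU₂ hU₃ hx => ?_
  have hent : clopenEnt X.R ⟨U₁, hU₁⟩ᶜ ⟨U₂, hU₂⟩ᶜ ⟨U₃, hU₃⟩ := fun y Z₁ Z₂ Z₃ hZ =>
    have ⟨k₁, k₂, k₃⟩ := X.isPSI.closed0 _ _ _ _ hZ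
    meets_iff.1 (hx _ _ _ (hX _ _ _ k₁ k₂ k₃ ⟨y, hZ⟩ x))
  exact meets_iff.2 fun hY₁ hY₂ hY₃ => h.2.2.2 ⟨_, _, _, hent, hY₁, hY₂, hY₃⟩

/-! ### Stone duality -/

section StoneDuality

variable {X Y : Type*} [TopologicalSpace X] [TopologicalSpace Y]

/-- The Boolean homomorphism of clopen algebras dual to a continuous map. -/
def clopensComap (f : C(X, Y)) : BoundedLatticeHom (Clopens Y) (Clopens X) where
  toFun U := ⟨f ⁻¹' U, U.isClopen.preimage f.continuous⟩
  map_sup' _ _ := rfl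
  map_inf' _ _ := rfl
  map_top' := rfl
  map_bot' := rfl

theorem image_subset_iff_subset_clopensComap {f : C(X, Y)} {Z : Set X} {U : Clopens Y} :
    f '' Z ⊆ U ↔ Z ⊆ clopensComap f U :=
  image_subset_iff

theorem disjoint_image_iff_disjoint_clopensComap {f : C(X, Y)} {Z : Set X} {U : Clopens Y} :
    Disjoint (f '' Z) U ↔ Disjoint Z (clopensComap f U : Set X) :=
  disjoint_image_left

/-- Evaluation of clopen sets at a point, as a two-valued Boolean homomorphism. -/
def clopensEval (x : X) : BoundedLatticeHom (Clopens X) Prop where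
  toFun U := x ∈ U
  map_sup' _ _ := rfl
  map_inf' _ _ := rfl
  map_top' := rfl
  map_bot' := rfl

theorem exists_eq_clopensEval [CompactSpace X] (h : BoundedLatticeHom (Clopens X) Prop) :
    ∃ x, h = clopensEval x := by
  have : Nonempty {U : Clopens X // h U} := ⟨⟨⊤, by simp⟩⟩
  obtain ⟨x, hx⟩ := IsCompact.nonempty_iInter_of_directed_nonempty_isCompact_isClosed
    (fun U : {U : Clopens X // h U} => (U.1 : Set X))
    (fun U V => ⟨⟨U.1 ⊓ V.1, by rw [map_inf]; exact ⟨U.2, V.2⟩⟩,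
      inter_subset_left, inter_subset_right⟩)
    (fun ⟨U, hU⟩ => by
      rw [nonempty_iff_ne_empty]
      rintro hempty
      obtain rfl : U = ⊥ := Clopens.ext hempty
      simp at hU)
    (fun U => U.1.isClosed.isCompact) (fun U => U.1.isClosed)
  have hmem : ∀ U, h U → x ∈ U := fun U hU => mem_iInter.1 hx ⟨U, hU⟩
  refine ⟨x, BoundedLatticeHom.ext fun U => propext ⟨hmem U, fun hxU => by_contra fun hU => ?_⟩⟩
  exact hmem Uᶜ (by rwa [map_compl']) hxU

theorem clopensComap_injective [TotallySeparatedSpace Y] :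
    Function.Injective (clopensComap : C(X, Y) → BoundedLatticeHom (Clopens Y) (Clopens X)) := by
  intro f g hfg
  ext x
  by_contra hne
  obtain ⟨U, hU, hfU, hgU⟩ := exists_isClopen_of_totally_separated hne
  have hmem : x ∈ clopensComap g ⟨U, hU⟩ := hfg ▸ hfU
  exact hgU hmem

theorem clopensComap_surjective [CompactSpace Y] [T2Space Y] [TotallyDisconnectedSpace Y] :
    Function.Surjective (clopensComap : C(X, Y) → BoundedLatticeHom (Clopens Y) (Clopens X)) := by
  intro h
  choose f hf using fun x => exists_eq_clopensEval ((clopensEval x).comp h)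
  have hpre : ∀ U : Clopens Y, f ⁻¹' U = h U := fun U =>
    Set.ext fun x => (iff_of_eq (DFunLike.congr_fun (hf x) U)).symm
  have hcont : Continuous f := isTopologicalBasis_isClopen.continuous_iff.2 fun U hU =>
    hpre ⟨U, hU⟩ ▸ (h ⟨U, hU⟩).isOpen
  exact ⟨⟨f, hcont⟩, BoundedLatticeHom.ext fun U => Clopens.ext (hpre U)⟩

theorem exists_clopensComap_le [CompactSpace X] [CompactSpace Y] [T2Space Y]
    [TotallyDisconnectedSpace Y] (f : C(X, Y)) {Z : Set Y} (hZ : IsClosed Z) {P : Clopens X}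
    (h : f ⁻¹' Z ⊆ P) : ∃ U : Clopens Y, Z ⊆ U ∧ clopensComap f U ≤ P := by
  have hopen : IsOpen (kernImage f (P : Set X)) :=
    isClosedMap_iff_kernImage.1 f.continuous.isClosedMap P.isOpen
  obtain ⟨U, hU, hZU, hUP⟩ :=
    exists_clopen_of_closed_subset_open hZ hopen (subset_kernImage_iff.2 h)
  exact ⟨⟨U, hU⟩, hZU, (subset_kernImage_iff (f := f)).1 hUP⟩

end StoneDuality

instance {R : Type*} [BooleanRing R] : TotallySeparatedSpace (PrimeSpectrum R) := by
  refine totallySeparatedSpace_iff_exists_isClopen.2 fun x y hxy => ?_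
  obtain ⟨a, ha⟩ : ∃ a, ¬ (a ∈ x.asIdeal ↔ a ∈ y.asIdeal) := by
    by_contra! h
    exact hxy (PrimeSpectrum.ext (Ideal.ext h))
  have hU : IsClopen (PrimeSpectrum.basicOpen a : Set (PrimeSpectrum R)) :=
    PrimeSpectrum.isClopen_iff.2 ⟨a, BooleanRing.isIdempotentElem a, rfl⟩
  by_cases hax : a ∈ x.asIdeal
  · have hay : a ∉ y.asIdeal := fun hay => ha (iff_of_true hax hay)
    exact ⟨_, hU.compl, not_not.2 hax, not_not.2 hay⟩
  · exact ⟨_, hU, hax, fun hay => ha (iff_of_false hax hay)⟩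

/-- Stone's representation of a Boolean algebra by the clopen subsets of its Stone space, which is
here the prime spectrum of the associated Boolean ring. -/
noncomputable def stoneIso (A : Type*) [BooleanAlgebra A] :
    A ≃o Clopens (PrimeSpectrum (AsBoolRing A)) :=
  OrderIso.trans
    { toEquiv := toBoolRing.trans (Equiv.subtypeUnivEquiv BooleanRing.isIdempotentElem).symm
      map_rel_iff' := ofBoolRing_le_ofBoolRing_iff.symm }
    PrimeSpectrum.isIdempotentElemEquivClopens

/-! ### Duality for maps -/

theorem PullsBackClopens.continuous {X₁ X₂ : PSISpace.{u}} {f : X₁ → X₂}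
    (hf : PullsBackClopens f) : Continuous f :=
  isTopologicalBasis_isClopen.continuous_iff.2 fun U hU => (hf U hU).isOpen

section Morphisms

section Refutes

variable {X Y : Type*} [TopologicalSpace X] [TopologicalSpace Y] {f : C(X, Y)}
  {E : Clopens X → Clopens X → Clopens X → Prop} {F : Clopens Y → Clopens Y → Clopens Y → Prop}

theorem Refutes.of_image {Y₁ Y₂ Y₃ : Set X}
    (hf : ∀ U V W, F U V W → E (clopensComap f U) (clopensComap f V) (clopensComap f W))
    (h : Refutes F (f '' Y₁) (f '' Y₂) (f '' Y₃)) : Refutes E Y₁ Y₂ Y₃ :=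
  have ⟨U, V, W, hUVW, hU, hV, hW⟩ := h
  ⟨_, _, _, hf U V W hUVW, image_subset_iff_subset_clopensComap.1 hU,
    image_subset_iff_subset_clopensComap.1 hV, disjoint_image_iff_disjoint_clopensComap.1 hW⟩

theorem Refutes.of_preimage [CompactSpace X] [CompactSpace Y] [T2Space Y]
    [TotallyDisconnectedSpace Y] (hE : IsEntailment E)
    (hf : ∀ U V W, E (clopensComap f U) (clopensComap f V) (clopensComap f W) → F U V W)
    {Z₁ Z₂ Z₃ : Set Y} (h₁ : IsClosed Z₁) (h₂ : IsClosed Z₂) (h₃ : IsClosed Z₃)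
    (h : Refutes E (f ⁻¹' Z₁) (f ⁻¹' Z₂) (f ⁻¹' Z₃)) : Refutes F Z₁ Z₂ Z₃ := by
  obtain ⟨P, Q, T, hPQT, hP, hQ, hT⟩ := h
  obtain ⟨U, hZU, hUP⟩ := exists_clopensComap_le f h₁ hP
  obtain ⟨V, hZV, hVQ⟩ := exists_clopensComap_le f h₂ hQ
  obtain ⟨W, hZW, hWT⟩ := exists_clopensComap_le f h₃ (P := Tᶜ) hT.subset_compl_right
  have hTW : T ≤ clopensComap f Wᶜ := by
    rw [map_compl']
    exact le_compl_comm.1 hWT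
  exact ⟨U, V, Wᶜ, hf U V Wᶜ (hE.mono hUP hVQ hTW hPQT), hZU, hZV,
    disjoint_compl_right_iff_subset.2 hZW⟩

end Refutes

instance {X : Type*} [TopologicalSpace X] [Nonempty X] : Nontrivial (Clopens X) :=
  ⟨⊥, ⊤, fun h => empty_ne_univ (congrArg SetLike.coe h)⟩

/-- The extended contact algebra of clopen sets of a non-empty PSI-space. -/
def PSISpace.toECA (X : PSISpace.{u}) [Nonempty X] : ECA.{u} where
  carrier := Clopens X
  Ent := clopenEnt X.R
  ec0 _ _ d _ := X.isPSI.isEntailment_clopenEnt.sup_right d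
  ec1 _ _ _ _ _ := X.isPSI.isEntailment_clopenEnt.cut
  ec2 := X.isPSI.isEntailment_clopenEnt.left_sup
  ec3 _ _ := X.isPSI.isEntailment_clopenEnt.le_of_self
  ec4 _ _ _ := X.isPSI.isEntailment_clopenEnt.symm

variable {X₁ X₂ : PSISpace.{u}} [Nonempty X₁] [Nonempty X₂] {f : C(X₁, X₂)}

theorem isPreserving_clopensComap_iff (h₂ : X₂.IsTotal) :
    IsPreserving (A := X₂.toECA) (B := X₁.toECA) (clopensComap f) ↔ IsHemiPSIMap f := by
  refine ⟨fun hf => ⟨fun U hU => hU.preimage f.continuous, fun x Y₁ Y₂ Y₃ hY => ?_⟩,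
    fun hf U V W hUVW x Y₁ Y₂ Y₃ hY hU hV hW => ?_⟩
  · obtain ⟨k₁, k₂, k₃, hn⟩ := PSISpace.closedRel_of_rel hY
    exact h₂.rel_iff_closedRel.2 ⟨f.continuous.isClosedMap _ k₁, f.continuous.isClosedMap _ k₂,
      f.continuous.isClosedMap _ k₃, fun hr => hn (hr.of_image hf)⟩
  · exact hUVW (f x) _ _ _ (hf.2 x Y₁ Y₂ Y₃ hY) (image_subset_iff_subset_clopensComap.2 hU)
      (image_subset_iff_subset_clopensComap.2 hV) (disjoint_image_iff_disjoint_clopensComap.2 hW)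

theorem isReflecting_clopensComap_iff (h₁ : X₁.IsTotal) (h₂ : X₂.IsTotal) :
    IsReflecting (A := X₂.toECA) (B := X₁.toECA) (clopensComap f) ↔ IsSemiPSIMap f := by
  refine ⟨fun hf => ⟨fun U hU => hU.preimage f.continuous, fun x Z₁ Z₂ Z₃ hZ => ?_⟩,
    fun hf U V W hUVW y Z₁ Z₂ Z₃ hZ hU hV hW => ?_⟩
  · obtain ⟨k₁, k₂, k₃, hn⟩ := PSISpace.closedRel_of_rel hZ
    have hpre : closedRel (clopenEnt X₁.R) (f ⁻¹' Z₁) (f ⁻¹' Z₂) (f ⁻¹' Z₃) :=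
      ⟨k₁.preimage f.continuous, k₂.preimage f.continuous, k₃.preimage f.continuous,
        fun hr => hn (hr.of_preimage X₁.isPSI.isEntailment_clopenEnt hf k₁ k₂ k₃)⟩
    exact ⟨_, _, _, h₁.rel_iff_closedRel.2 hpre, image_preimage_subset f Z₁,
      image_preimage_subset f Z₂, image_preimage_subset f Z₃⟩
  · obtain ⟨x⟩ := ‹Nonempty X₁›
    have hfx : X₂.R (f x) Z₁ Z₂ Z₃ := h₂.rel_iff_closedRel.2 (PSISpace.closedRel_of_rel hZ)
    obtain ⟨Y₁, Y₂, Y₃, hY, hYZ₁, hYZ₂, hYZ₃⟩ := hf.2 x Z₁ Z₂ Z₃ hfx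
    exact hUVW x Y₁ Y₂ Y₃ hY (image_subset_iff_subset_clopensComap.1 (hYZ₁.trans hU))
      (image_subset_iff_subset_clopensComap.1 (hYZ₂.trans hV))
      (disjoint_image_iff_disjoint_clopensComap.1 (hW.mono_left hYZ₃))

theorem isSimilarity_clopensComap_iff (h₁ : X₁.IsTotal) (h₂ : X₂.IsTotal) :
    IsSimilarity (A := X₂.toECA) (B := X₁.toECA) (clopensComap f) ↔ IsPSIMap f :=
  and_congr (isReflecting_clopensComap_iff h₁ h₂) (isPreserving_clopensComap_iff h₂)

end Morphisms

/-! ### The total PSI-space of an extended contact algebra -/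

namespace ECA

variable (A : ECA.{u})

theorem isEntailment_stoneIso_symm : IsEntailment fun U V W =>
    A.Ent ((stoneIso A).symm U) ((stoneIso A).symm V) ((stoneIso A).symm W) :=
  A.isEntailment.comap (stoneIso A).symm

/-- The total PSI-space dual to an extended contact algebra, on the Stone space of its underlying
Boolean algebra. -/
def toPSISpace : PSISpace.{u} where
  carrier := PrimeSpectrum (AsBoolRing A)
  R _ := closedRel fun U V W =>
    A.Ent ((stoneIso A).symm U) ((stoneIso A).symm V) ((stoneIso A).symm W)
  isPSI := isPSISpace_closedRel A.isEntailment_stoneIso_symm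

instance : Nonempty A.toPSISpace :=
  have : Nontrivial (AsBoolRing A) := toBoolRing.symm.nontrivial
  inferInstanceAs (Nonempty (PrimeSpectrum (AsBoolRing A)))

theorem isTotal_toPSISpace : A.toPSISpace.IsTotal :=
  fun _ _ _ _ _ _ ⟨_, h⟩ _ => h

/-- Stone's representation, inverted, between an extended contact algebra and its double dual. -/
noncomputable def doubleDualIso : A.toPSISpace.toECA ≃o A :=
  (stoneIso A).symm

theorem isSimilarity_doubleDualIso :
    IsSimilarity (A.doubleDualIso : BoundedLatticeHom A.toPSISpace.toECA A) := by
  have : Nonempty (PrimeSpectrum (AsBoolRing A)) := inferInstanceAs (Nonempty A.toPSISpace)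
  exact ⟨fun _ _ _ => (clopenEnt_closedRel_iff A.isEntailment_stoneIso_symm).2,
    fun _ _ _ => (clopenEnt_closedRel_iff A.isEntailment_stoneIso_symm).1⟩

end ECA

theorem IsSimilarity.symm {A B : ECA.{u}} {e : A ≃o B}
    (he : IsSimilarity (e : BoundedLatticeHom A B)) :
    IsSimilarity (e.symm : BoundedLatticeHom B A) := by
  have h : ∀ U V W, A.Ent (e.symm U) (e.symm V) (e.symm W) ↔ B.Ent U V W := fun U V W => by
    simpa using (⟨he.2 _ _ _, he.1 _ _ _⟩ : A.Ent (e.symm U) (e.symm V) (e.symm W) ↔ _)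
  exact ⟨fun U V W => (h U V W).1, fun U V W => (h U V W).2⟩

/-! ### The dual equivalences -/

instance (X : TPSISp0.{u}) : Nonempty X.obj.toPSISpace := X.property.1

instance (X : TPSISp1.{u}) : Nonempty X.obj.toPSISpace := X.property.1

instance (X : TPSISp2.{u}) : Nonempty X.obj.toPSISpace := X.property.1

/-- The functor of clopen algebras on total PSI-spaces with semi-PSI maps. -/
def clopenFunctor0 : TPSISp0.{u}ᵒᵖ ⥤ EC0.{u} where
  obj X := ⟨X.unop.obj.toPSISpace.toECA⟩
  map {X Y} f := ⟨clopensComap ⟨f.unop.hom.1, f.unop.hom.2.1.continuous⟩,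
    (isReflecting_clopensComap_iff Y.unop.property.2 X.unop.property.2).2 f.unop.hom.2⟩

/-- The functor of clopen algebras on total PSI-spaces with hemi-PSI maps. -/
def clopenFunctor1 : TPSISp1.{u}ᵒᵖ ⥤ EC1.{u} where
  obj X := ⟨X.unop.obj.toPSISpace.toECA⟩
  map {X Y} f := ⟨clopensComap ⟨f.unop.hom.1, f.unop.hom.2.1.continuous⟩,
    (isPreserving_clopensComap_iff X.unop.property.2).2 f.unop.hom.2⟩

/-- The functor of clopen algebras on total PSI-spaces with PSI maps. -/
def clopenFunctor2 : TPSISp2.{u}ᵒᵖ ⥤ EC2.{u} where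
  obj X := ⟨X.unop.obj.toPSISpace.toECA⟩
  map {X Y} f := ⟨clopensComap ⟨f.unop.hom.1, f.unop.hom.2.1.1.continuous⟩,
    (isSimilarity_clopensComap_iff Y.unop.property.2 X.unop.property.2).2 f.unop.hom.2⟩

instance : clopenFunctor0.{u}.IsEquivalence where
  faithful.map_injective h := Quiver.Hom.unop_inj <| ObjectProperty.hom_ext _ <| Subtype.ext <|
    congrArg DFunLike.coe (clopensComap_injective (congrArg Subtype.val h))
  full.map_surjective {X Y} := by
    rintro ⟨h, hh⟩
    obtain ⟨f, rfl⟩ := clopensComap_surjective h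
    exact ⟨Quiver.Hom.op (ObjectProperty.homMk ⟨f,
      (isReflecting_clopensComap_iff Y.unop.property.2 X.unop.property.2).1 hh⟩), rfl⟩
  essSurj.mem_essImage A :=
    ⟨op ⟨⟨A.toECA.toPSISpace⟩, inferInstance, A.toECA.isTotal_toPSISpace⟩, ⟨{
      hom := ⟨_, A.toECA.isSimilarity_doubleDualIso.1⟩
      inv := ⟨_, A.toECA.isSimilarity_doubleDualIso.symm.1⟩
      hom_inv_id := Subtype.ext <| BoundedLatticeHom.ext A.toECA.doubleDualIso.symm_apply_apply
      inv_hom_id := Subtype.ext <| BoundedLatticeHom.ext A.toECA.doubleDualIso.apply_symm_apply }⟩⟩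

instance : clopenFunctor1.{u}.IsEquivalence where
  faithful.map_injective h := Quiver.Hom.unop_inj <| ObjectProperty.hom_ext _ <| Subtype.ext <|
    congrArg DFunLike.coe (clopensComap_injective (congrArg Subtype.val h))
  full.map_surjective {X Y} := by
    rintro ⟨h, hh⟩
    obtain ⟨f, rfl⟩ := clopensComap_surjective h
    exact ⟨Quiver.Hom.op (ObjectProperty.homMk ⟨f,
      (isPreserving_clopensComap_iff X.unop.property.2).1 hh⟩), rfl⟩
  essSurj.mem_essImage A :=
    ⟨op ⟨⟨A.toECA.toPSISpace⟩, inferInstance, A.toECA.isTotal_toPSISpace⟩, ⟨{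
      hom := ⟨_, A.toECA.isSimilarity_doubleDualIso.2⟩
      inv := ⟨_, A.toECA.isSimilarity_doubleDualIso.symm.2⟩
      hom_inv_id := Subtype.ext <| BoundedLatticeHom.ext A.toECA.doubleDualIso.symm_apply_apply
      inv_hom_id := Subtype.ext <| BoundedLatticeHom.ext A.toECA.doubleDualIso.apply_symm_apply }⟩⟩

instance : clopenFunctor2.{u}.IsEquivalence where
  faithful.map_injective h := Quiver.Hom.unop_inj <| ObjectProperty.hom_ext _ <| Subtype.ext <|
    congrArg DFunLike.coe (clopensComap_injective (congrArg Subtype.val h))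
  full.map_surjective {X Y} := by
    rintro ⟨h, hh⟩
    obtain ⟨f, rfl⟩ := clopensComap_surjective h
    exact ⟨Quiver.Hom.op (ObjectProperty.homMk ⟨f,
      (isSimilarity_clopensComap_iff Y.unop.property.2 X.unop.property.2).1 hh⟩), rfl⟩
  essSurj.mem_essImage A :=
    ⟨op ⟨⟨A.toECA.toPSISpace⟩, inferInstance, A.toECA.isTotal_toPSISpace⟩, ⟨{
      hom := ⟨_, A.toECA.isSimilarity_doubleDualIso⟩
      inv := ⟨_, A.toECA.isSimilarity_doubleDualIso.symm⟩
      hom_inv_id := Subtype.ext <| BoundedLatticeHom.ext A.toECA.doubleDualIso.symm_apply_apply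
      inv_hom_id := Subtype.ext <| BoundedLatticeHom.ext A.toECA.doubleDualIso.apply_symm_apply }⟩⟩

end ExtContact

theorem mainTheorem12 :
    Nonempty (ExtContact.EC0.{u}ᵒᵖ ≌ ExtContact.TPSISp0.{u}) ∧
    Nonempty (ExtContact.EC1.{u}ᵒᵖ ≌ ExtContact.TPSISp1.{u}) ∧
    Nonempty (ExtContact.EC2.{u}ᵒᵖ ≌ ExtContact.TPSISp2.{u}) :=
  ⟨⟨ExtContact.clopenFunctor0.asEquivalence.rightOp.symm⟩,
    ⟨ExtContact.clopenFunctor1.asEquivalence.rightOp.symm⟩,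
    ⟨ExtContact.clopenFunctor2.asEquivalence.rightOp.symm⟩⟩
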